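/- Let $\Lambda\subset\mathbf{C}$ be a lattice (generated over $\mathbf{Z}$ by two $\mathbf{R}$-linearly independent periods), let $\sigma(z)=z\prod_{l\in\Lambda\setminus\{0\}}\bigl(1-\frac{z}{l}\bigr)e^{z/l+z^2/(2l^2)}$ be its Weierstrass sigma function and $\zeta=\sigma'/\sigma$ its Weierstrass zeta function. Let $t_1,\dots,t_N,\lambda_1,\dots,\lambda_N,q\in\mathbf{C}$ be such that the $t_j$ are pairwise distinct modulo $\Lambda$, the $\lambda_j$ are pairwise distinct modulo $\Lambda$, $\lambda_k\not\equiv t_j$ modulo $\Lambda$ for all $j,k$, and $$\sigma(q)\neq 0,\qquad \sum_{j=1}^N\lambda_j-\sum_{j=1}^N t_j=q .$$ Put $Q(z)=\prod_{j=1}^N\sigma(z-\lambda_j)$ and $P(z)=\prod_{j=1}^N\sigma(z-t_j)$. Then for all $b_1,\dots,b_N\in\mathbf{C}$ the system of linear equations $$\sum_{j=1}^N\zeta(\lambda_k-t_j)X_j+X_0=b_k\quad(k=1,\dots,N),\qquad \sum_{j=1}^N X_j=0$$ has a unique solution $(X_0,X_1,\dots,X_N)\in\mathbf{C}^{N+1}$,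 and it is given by $$X_j=\sum_{k=1}^N\frac{Q(t_j)P(\lambda_k)\,\sigma(t_j-\lambda_k+q)\,b_k}{P'(t_j)Q'(\lambda_k)\,\sigma(t_j-\lambda_k)\,\sigma(q)}\quad(j=1,\dots,N),$$ $$X_0=-\sum_{j,k=1}^N\frac{Q(t_j)P(\lambda_k)\,\sigma(t_j-\lambda_k+q)\,\zeta(\lambda_k-t_j-q)\,b_k}{P'(t_j)Q'(\lambda_k)\,\sigma(t_j-\lambda_k)\,\sigma(q)},$$ where, if $t_j-\lambda_k+q\in\Lambda$, the product $\sigma(t_j-\lambda_k+q)\,\zeta(\lambda_k-t_j-q)$ is understood as its limit value $-\sigma'(t_j-\lambda_k+q)$. -/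

import Mathlib

noncomputable section

namespace PeriodPair

/-- The general factor of the Weierstrass product, `(1 - z/l) exp (z/l + z²/(2l²))`, for a nonzero
lattice point `l`; the factor of `l = 0` is `1`. -/
def sigmaFactor (l z : ℂ) : ℂ :=
  if l = 0 then 1 else (1 - z / l) * Complex.exp (z / l + z ^ 2 / (2 * l ^ 2))

/-- The Weierstrass sigma function
`σ(z) = z ∏_{l ∈ Λ, l ≠ 0} (1 - z/l) exp (z/l + z²/(2l²))` of the period lattice `Λ`. -/
def weierstrassSigma (L : PeriodPair) (z : ℂ) : ℂ :=
  z * ∏' l : L.lattice, sigmaFactor (l : ℂ) z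

/-- The Weierstrass zeta function `ζ(z) = σ'(z) / σ(z)`. -/
def weierstrassZeta (L : PeriodPair) (z : ℂ) : ℂ :=
  deriv L.weierstrassSigma z / L.weierstrassSigma z

/-- For a tuple `a = (a₁, …, a_N)`, the function `z ↦ ∏ⱼ σ(z - aⱼ)`. -/
def sigmaProd (L : PeriodPair) {N : ℕ} (a : Fin N → ℂ) (z : ℂ) : ℂ :=
  ∏ j, L.weierstrassSigma (z - a j)

open Classical in
/-- The entire function `w ↦ σ(w) ζ(-w)`. At a lattice point the zero of `σ` cancels the pole of
`ζ`, and the product takes its limit value there: as `ζ(-w) = -ζ(w) = -σ'(w)/σ(w)`, this limit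
value is `-σ'(w)`. -/
def sigmaMulZetaNeg (L : PeriodPair) (w : ℂ) : ℂ :=
  if w ∈ L.lattice then -deriv L.weierstrassSigma w
  else L.weierstrassSigma w * L.weierstrassZeta (-w)

/-- `(X₀, X₁, …, X_N)` solves the linear system
`∑ⱼ ζ(λₖ - tⱼ) Xⱼ + X₀ = bₖ` (`k = 1, …, N`), `∑ⱼ Xⱼ = 0`. -/
def SolvesZetaSystem (L : PeriodPair) {N : ℕ} (t lam b : Fin N → ℂ)
    (X₀ : ℂ) (X : Fin N → ℂ) : Prop :=
  (∀ k, ∑ j, L.weierstrassZeta (lam k - t j) * X j + X₀ = b k) ∧ ∑ j, X j = 0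

/-- The explicit `Xⱼ`, with `Q(z) = ∏ⱼ σ(z - λⱼ)` and `P(z) = ∏ⱼ σ(z - tⱼ)`:
`Xⱼ = ∑ₖ Q(tⱼ) P(λₖ) σ(tⱼ - λₖ + q) bₖ / (P'(tⱼ) Q'(λₖ) σ(tⱼ - λₖ) σ(q))`. -/
def zetaSystemX (L : PeriodPair) {N : ℕ} (q : ℂ) (t lam b : Fin N → ℂ) (j : Fin N) : ℂ :=
  ∑ k, L.sigmaProd lam (t j) * L.sigmaProd t (lam k)
        * L.weierstrassSigma (t j - lam k + q) * b k
      / (deriv (L.sigmaProd t) (t j) * deriv (L.sigmaProd lam) (lam k)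
        * L.weierstrassSigma (t j - lam k) * L.weierstrassSigma q)

/-- The explicit `X₀`, with `Q` and `P` as before:
`X₀ = - ∑_{j,k} Q(tⱼ) P(λₖ) σ(tⱼ - λₖ + q) ζ(λₖ - tⱼ - q) bₖ
  / (P'(tⱼ) Q'(λₖ) σ(tⱼ - λₖ) σ(q))`,
where `σ(w) ζ(-w)`, `w = tⱼ - λₖ + q`, is continued to lattice points `w`. -/
def zetaSystemX₀ (L : PeriodPair) {N : ℕ} (q : ℂ) (t lam b : Fin N → ℂ) : ℂ :=
  -∑ j, ∑ k, L.sigmaProd lam (t j) * L.sigmaProd t (lam k)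
        * L.sigmaMulZetaNeg (t j - lam k + q) * b k
      / (deriv (L.sigmaProd t) (t j) * deriv (L.sigmaProd lam) (lam k)
        * L.weierstrassSigma (t j - lam k) * L.weierstrassSigma q)

end PeriodPair

end

/-!
The explicit solution is checked by two applications of the residue theorem for elliptic functions,
and uniqueness then follows because the system is square.

Write `Q_k(z) = ∏_{i ≠ k} σ(z - λᵢ)` and `w = z - λ_k + q`. Up to factors independent of `j`, the
coefficient of `b_k` in `Xⱼ` is the residue at `tⱼ` of the elliptic function `Q_k(z) σ(w) / P(z)`,
whose only poles are the `tⱼ`; so `∑ⱼ Xⱼ = 0`. Likewise the `m`-th equation collects the residues at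
the `tⱼ` of `Q_k(z) (σ'(w) σ(u) - σ(w) σ'(u)) / (P(z) σ(u))`, `u = z - λ_m`. The only other pole is
`λ_m`, and its residue vanishes unless `k = m`, because of the factor `Q_k`. These are
`PeriodPair.sum_sigma_quotient_eq_zero` and `PeriodPair.sum_sigma_quotient_mul_zeta`. Writing
`-σ'(w)` for `σ(w) ζ(-w)` makes the case of lattice points `w` the same as the general one.

The residue theorem is needed only for quotients `F / ∏ σ(z - aᵢ)` with simple poles, and
`PeriodPair.sum_div_prod_weierstrassSigma_eq_zero` proves it without contour integrals. Subtracting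
`∑ cᵢ ζ(z - aᵢ)`, where `cᵢ` are the residues, leaves an entire function `E` with
`E(z + ω) = E(z) - R η(ω)`, where `R = ∑ cᵢ` and `η(ω)` is the quasi-period of `ζ`. By Liouville's
theorem `E'` is constant, so if `R ≠ 0` then `η(ω) = c ω` for some constant `c`. Then
`σ(z) exp(-c z² / 2)` is multiplied by constants under lattice translations; a further factor
`exp(-a z)` makes its modulus periodic, so it is constant, hence zero as `σ(0) = 0`: a contradiction
(`PeriodPair.not_forall_quasiPeriod_eq_mul`).

The quasi-periodicity of `σ` itself comes from `ζ' = -℘` and the periodicity of `℘`.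
-/

noncomputable section

open Filter Topology Set

/-! ### Convergence of the product, zeros and parity of the sigma function -/

/-- The elementary factor of genus two is `1 + O(u³)`. -/
lemma Complex.norm_one_sub_mul_exp_sub_one_le {u : ℂ} (hu : ‖u‖ ≤ 1 / 2) :
    ‖(1 - u) * Complex.exp (u + u ^ 2 / 2) - 1‖ ≤ 2 * ‖u‖ ^ 3 := by
  have h1 : (1 : ℂ) - u ≠ 0 := by
    intro h
    have : u = 1 := by linear_combination -h
    rw [this] at hu
    norm_num at hu
  have hlog : ‖Complex.log (1 - u) + u + u ^ 2 / 2‖ ≤ ‖u‖ ^ 3 := by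
    have h := Complex.norm_log_sub_logTaylor_le 2 (z := -u) (by rw [norm_neg]; linarith)
    have e : Complex.logTaylor (2 + 1) (-u) = -u - u ^ 2 / 2 := by
      simp [Complex.logTaylor, Finset.sum_range_succ]
      ring
    rw [e, norm_neg] at h
    rw [show Complex.log (1 - u) + u + u ^ 2 / 2
      = Complex.log (1 + -u) - (-u - u ^ 2 / 2) by rw [← sub_eq_add_neg]; ring]
    refine h.trans ?_
    have h2 : (1 - ‖u‖)⁻¹ ≤ 2 := by
      rw [inv_le_comm₀ (by linarith) (by norm_num)]; linarith
    have h3 : 0 ≤ ‖u‖ ^ 3 := by positivity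
    norm_num
    nlinarith
  have hu3 : ‖u‖ ^ 3 ≤ 1 := by
    calc ‖u‖ ^ 3 ≤ (1 / 2) ^ 3 := by gcongr
      _ ≤ 1 := by norm_num
  have e : (1 - u) * Complex.exp (u + u ^ 2 / 2)
      = Complex.exp (Complex.log (1 - u) + u + u ^ 2 / 2) := by
    rw [add_assoc, Complex.exp_add _ (u + u ^ 2 / 2), Complex.exp_log h1]
  rw [e]
  exact (Complex.norm_exp_sub_one_le (hlog.trans hu3)).trans (by linarith)

namespace PeriodPair

variable (L : PeriodPair)

lemma sigmaFactor_sub_one_bound {r : ℝ} (hr : 0 < r) {z : ℂ} (hz : ‖z‖ < r) {l : ℂ}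
    (hl : 2 * r ≤ ‖l‖) : ‖sigmaFactor l z - 1‖ ≤ 2 * r ^ 3 * ‖l‖ ^ (-3 : ℝ) := by
  have hl0 : 0 < ‖l‖ := by linarith
  have hl' : l ≠ 0 := norm_pos_iff.mp hl0
  have h := Complex.norm_one_sub_mul_exp_sub_one_le (u := z / l) (by
    rw [norm_div, div_le_iff₀ hl0]; linarith)
  rw [sigmaFactor, if_neg hl', show z ^ 2 / (2 * l ^ 2) = (z / l) ^ 2 / 2 by field]
  refine h.trans ?_
  rw [norm_div, div_pow, Real.rpow_neg hl0.le]
  norm_cast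
  rw [← div_eq_mul_inv, mul_div_assoc]
  gcongr

lemma eventually_cofinite_le_norm (r : ℝ) : ∀ᶠ l : L.lattice in cofinite, r ≤ ‖(l : ℂ)‖ := by
  refine (isCompact_iff_finite.mp (isCompact_closedBall (0 : L.lattice) r)).subset ?_
  intro l hl
  simp only [mem_compl_iff, mem_ofPred_eq, not_le] at hl
  simpa using hl.le

lemma eventually_sigmaFactor_sub_one_bound {r : ℝ} (hr : 0 < r) :
    ∀ᶠ l : L.lattice in cofinite, ∀ z ∈ Metric.ball (0 : ℂ) r,
      ‖sigmaFactor (l : ℂ) z - 1‖ ≤ 2 * r ^ 3 * ‖l‖ ^ (-3 : ℝ) := by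
  filter_upwards [L.eventually_cofinite_le_norm (2 * r)] with l hl z hz
  exact sigmaFactor_sub_one_bound hr (by simpa using hz) hl

lemma summable_sigmaFactor_bound (r : ℝ) :
    Summable fun l : L.lattice ↦ 2 * r ^ 3 * ‖l‖ ^ (-3 : ℝ) :=
  (ZLattice.summable_norm_rpow _ _ (by simp; norm_num)).mul_left _

lemma differentiable_sigmaFactor (l : ℂ) : Differentiable ℂ (sigmaFactor l) := by
  unfold sigmaFactor
  split_ifs <;> fun_prop

lemma hasProdLocallyUniformlyOn_sigmaFactor {r : ℝ} (hr : 0 < r) :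
    HasProdLocallyUniformlyOn (fun (l : L.lattice) z ↦ sigmaFactor l z)
      (fun z ↦ ∏' l : L.lattice, sigmaFactor l z) (Metric.ball 0 r) := by
  simpa using Summable.hasProdLocallyUniformlyOn_one_add
    (Metric.isOpen_ball (x := (0 : ℂ)) (ε := r))
    (L.summable_sigmaFactor_bound r) (L.eventually_sigmaFactor_sub_one_bound hr)
    (fun l ↦ ((differentiable_sigmaFactor l).continuous.sub continuous_const).continuousOn)

lemma differentiable_tprod_sigmaFactor :
    Differentiable ℂ (fun z ↦ ∏' l : L.lattice, sigmaFactor l z) := by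
  intro z
  have hr : 0 < ‖z‖ + 1 := by positivity
  refine ((L.hasProdLocallyUniformlyOn_sigmaFactor hr).differentiableOn
    (.of_forall fun s ↦ ?_) Metric.isOpen_ball).differentiableAt
    (Metric.isOpen_ball.mem_nhds (by simp))
  exact DifferentiableOn.fun_finsetProd fun l _ ↦ (differentiable_sigmaFactor l).differentiableOn

lemma summable_norm_sigmaFactor_sub_one (z : ℂ) :
    Summable fun l : L.lattice ↦ ‖sigmaFactor (l : ℂ) z - 1‖ := by
  have hr : 0 < ‖z‖ + 1 := by positivity
  refine (L.summable_sigmaFactor_bound (‖z‖ + 1)).of_norm_bounded_eventually ?_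
  filter_upwards [L.eventually_sigmaFactor_sub_one_bound hr] with l hl
  simpa using hl z (by simp)

lemma sigmaFactor_ne_zero {l z : ℂ} (h : l ≠ 0 → z ≠ l) : sigmaFactor l z ≠ 0 := by
  unfold sigmaFactor
  split_ifs with hl
  · exact one_ne_zero
  · refine mul_ne_zero ?_ (Complex.exp_ne_zero _)
    rw [sub_ne_zero, ne_comm, Ne, div_eq_one_iff_eq hl]
    exact h hl

lemma tprod_sigmaFactor_ne_zero {z : ℂ} (hz : z ∉ L.lattice) :
    ∏' l : L.lattice, sigmaFactor l z ≠ 0 := by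
  simpa using tprod_one_add_ne_zero_of_summable
    (f := fun l : L.lattice ↦ sigmaFactor (l : ℂ) z - 1)
    (fun l ↦ by simpa using sigmaFactor_ne_zero (by rintro - rfl; exact hz l.2))
    (L.summable_norm_sigmaFactor_sub_one z)

lemma differentiable_weierstrassSigma : Differentiable ℂ L.weierstrassSigma :=
  differentiable_id.mul L.differentiable_tprod_sigmaFactor

lemma weierstrassSigma_ne_zero {z : ℂ} (hz : z ∉ L.lattice) : L.weierstrassSigma z ≠ 0 :=
  mul_ne_zero (by rintro rfl; exact hz (zero_mem _)) (L.tprod_sigmaFactor_ne_zero hz)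

@[simp] lemma weierstrassSigma_zero : L.weierstrassSigma 0 = 0 := by simp [weierstrassSigma]

@[simp] lemma deriv_weierstrassSigma_zero : deriv L.weierstrassSigma 0 = 1 := by
  have h : HasDerivAt L.weierstrassSigma _ 0 :=
    (hasDerivAt_id (0 : ℂ)).mul (L.differentiable_tprod_sigmaFactor 0).hasDerivAt
  rw [h.deriv]
  simp [sigmaFactor]

@[simp] lemma weierstrassSigma_neg (z : ℂ) :
    L.weierstrassSigma (-z) = -L.weierstrassSigma z := by
  simp only [weierstrassSigma]
  rw [← (Equiv.neg L.lattice).tprod_eq, neg_mul]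
  congr! 3 with l
  simp [sigmaFactor, neg_div_neg_eq]

lemma deriv_weierstrassSigma_neg (z : ℂ) :
    deriv L.weierstrassSigma (-z) = deriv L.weierstrassSigma z := by
  have h := deriv_comp_neg L.weierstrassSigma z
  have e : (fun x ↦ L.weierstrassSigma (-x)) = -L.weierstrassSigma :=
    funext L.weierstrassSigma_neg
  rw [e, deriv.neg'] at h
  linear_combination h

/-! ### The zeta function as a lattice sum, and quasi-periodicity -/

/-- The general term of the partial fraction expansion of `ζ`. At `l = 0` it is `1 / z`, because
of the convention `x / 0 = 0`. -/
def zetaTerm (l z : ℂ) : ℂ := 1 / (z - l) + 1 / l + z / l ^ 2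

lemma zetaTerm_bound {r : ℝ} {z : ℂ} (hz : ‖z‖ < r) {l : ℂ}
    (hl : 2 * r ≤ ‖l‖) : ‖zetaTerm l z‖ ≤ 2 * r ^ 2 * ‖l‖ ^ (-3 : ℝ) := by
  have hr : 0 < r := (norm_nonneg z).trans_lt hz
  have hl0 : 0 < ‖l‖ := by linarith
  have hl' : l ≠ 0 := norm_pos_iff.mp hl0
  have hzl : ‖l‖ / 2 ≤ ‖z - l‖ := by
    rw [norm_sub_rev]
    exact .trans (by linarith) (norm_sub_norm_le l z)
  have hzl' : z - l ≠ 0 := norm_pos_iff.mp (by linarith)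
  have e : zetaTerm l z = z ^ 2 / (l ^ 2 * (z - l)) := by
    unfold zetaTerm; field_simp; ring
  rw [e, norm_div, norm_mul, norm_pow, norm_pow, Real.rpow_neg hl0.le]
  calc ‖z‖ ^ 2 / (‖l‖ ^ 2 * ‖z - l‖) ≤ r ^ 2 / (‖l‖ ^ 2 * (‖l‖ / 2)) := by gcongr
    _ = _ := by norm_cast; field

lemma hasSumLocallyUniformly_zetaTerm :
    HasSumLocallyUniformly (fun (l : L.lattice) z ↦ zetaTerm l z)
      (fun z ↦ ∑' l : L.lattice, zetaTerm l z) := by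
  refine L.hasSumLocallyUniformly_aux (fun (l : L.lattice) z ↦ zetaTerm l z)
    (u := (2 * · ^ 2 * ‖·‖ ^ (-3 : ℝ)))
    (fun _ _ ↦ (ZLattice.summable_norm_rpow _ _ (by simp; norm_num)).mul_left _) fun r hr ↦
    Filter.eventually_atTop.mpr ⟨2 * r, ?_⟩
  rintro _ h s hs l rfl
  exact zetaTerm_bound hs h

lemma logDeriv_sigmaFactor {l z : ℂ} (hz : z ≠ l) :
    logDeriv (sigmaFactor l) z = if l = 0 then 0 else zetaTerm l z := by
  split_ifs with hl
  · have : sigmaFactor l = fun _ ↦ 1 := by ext; simp [sigmaFactor, hl]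
    rw [this]; simp
  · have hzl : z - l ≠ 0 := sub_ne_zero.mpr hz
    have hlz : l - z ≠ 0 := sub_ne_zero.mpr hz.symm
    have h : HasDerivAt (sigmaFactor l)
        ((-(1 / l)) * Complex.exp (z / l + z ^ 2 / (2 * l ^ 2)) + (1 - z / l) *
          (Complex.exp (z / l + z ^ 2 / (2 * l ^ 2)) * (1 / l + 2 * z / (2 * l ^ 2)))) z := by
      have : sigmaFactor l = fun z ↦ (1 - z / l) * Complex.exp (z / l + z ^ 2 / (2 * l ^ 2)) := by
        ext; simp [sigmaFactor, hl]
      rw [this]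
      refine HasDerivAt.fun_mul ?_ (HasDerivAt.cexp ?_)
      · simpa using ((hasDerivAt_id z).div_const l).const_sub 1
      · simpa using! ((hasDerivAt_id z).div_const l).add
          (((hasDerivAt_id z).pow 2).div_const (2 * l ^ 2))
    rw [logDeriv_apply, h.deriv, sigmaFactor, if_neg hl, zetaTerm]
    have he := Complex.exp_ne_zero (z / l + z ^ 2 / (2 * l ^ 2))
    generalize Complex.exp (z / l + z ^ 2 / (2 * l ^ 2)) = E at *
    have h1 : 1 - z / l ≠ 0 := by
      rw [sub_ne_zero, ne_comm, Ne, div_eq_one_iff_eq hl]; exact hz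
    rw [div_eq_iff (mul_ne_zero h1 he)]
    field_simp
    ring

/-- The partial fraction expansion of the Weierstrass zeta function. -/
lemma weierstrassZeta_eq_tsum {z : ℂ} (hz : z ∉ L.lattice) :
    L.weierstrassZeta z = ∑' l : L.lattice, zetaTerm l z := by
  have hz0 : z ≠ 0 := by rintro rfl; exact hz (zero_mem _)
  have hr : 0 < ‖z‖ + 1 := by positivity
  have hzl (l : L.lattice) : z ≠ l := by rintro rfl; exact hz l.2
  have hsum : Summable fun l : L.lattice ↦ zetaTerm l z :=
    L.hasSumLocallyUniformly_zetaTerm.hasSum.summable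
  have hterm (l : L.lattice) : logDeriv (sigmaFactor l) z = if l = 0 then 0 else zetaTerm l z := by
    simpa using logDeriv_sigmaFactor (hzl l)
  have h1 : logDeriv (fun z ↦ ∏' l : L.lattice, sigmaFactor l z) z
      = ∑' l : L.lattice, if l = 0 then 0 else zetaTerm l z := by
    rw [logDeriv_tprod_eq_tsum (Metric.isOpen_ball (x := (0 : ℂ)) (ε := ‖z‖ + 1)) (by simp)
      (fun l ↦ sigmaFactor_ne_zero fun _ ↦ hzl l)
      (fun l ↦ (differentiable_sigmaFactor l).differentiableOn) ?_
      (L.hasProdLocallyUniformlyOn_sigmaFactor hr).multipliableLocallyUniformlyOn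
      (L.tprod_sigmaFactor_ne_zero hz)]
    · simp_rw [hterm]
    · simp_rw [hterm]
      refine hsum.congr_cofinite ?_
      filter_upwards [(finite_singleton (0 : L.lattice)).compl_mem_cofinite] with l hl
      rw [if_neg (by simpa using hl)]
  have h2 : L.weierstrassZeta z = logDeriv (fun z : ℂ ↦ z) z
      + logDeriv (fun z ↦ ∏' l : L.lattice, sigmaFactor l z) z :=
    logDeriv_mul z hz0 (L.tprod_sigmaFactor_ne_zero hz) differentiableAt_id
      (L.differentiable_tprod_sigmaFactor z)
  rw [h2, h1, hsum.tsum_eq_add_tsum_ite 0]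
  congr 1
  simp [logDeriv_apply, zetaTerm]

lemma isPreconnected_compl_lattice : IsPreconnected ((L.lattice : Set ℂ)ᶜ) := by
  refine (Set.Countable.isConnected_compl_of_one_lt_rank (by simp) ?_).isPreconnected
  exact countable_of_Lindelof_of_discrete (X := L.lattice)

lemma isOpen_compl_lattice : IsOpen ((L.lattice : Set ℂ)ᶜ) := L.isClosed_lattice.isOpen_compl

lemma hasDerivAt_weierstrassZeta {z : ℂ} (hz : z ∉ L.lattice) :
    HasDerivAt L.weierstrassZeta (-L.weierstrassP z) z := by
  have hU := L.isOpen_compl_lattice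
  have hd (l : L.lattice) (x : ℂ) (hx : x ∈ (L.lattice : Set ℂ)ᶜ) :
      HasDerivAt (zetaTerm l) (-(1 / (x - l) ^ 2 - 1 / (l : ℂ) ^ 2)) x := by
    have hxl : x - l ≠ 0 := sub_ne_zero.mpr (by rintro rfl; exact hx l.2)
    have := (((hasDerivAt_id x).sub_const (l : ℂ)).fun_inv hxl).add_const (1 / (l : ℂ))
      |>.add ((hasDerivAt_id x).div_const ((l : ℂ) ^ 2))
    have e : zetaTerm l = (fun y : ℂ ↦ (id y - l)⁻¹ + 1 / (l : ℂ)) + fun y ↦ id y / (l : ℂ) ^ 2 := by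
      ext y; simp [zetaTerm]
    rw [e]
    refine HasDerivAt.congr_deriv this ?_
    rw [id_eq]
    ring
  have hdiff (s : Finset L.lattice) : DifferentiableOn ℂ (fun z ↦ ∑ l ∈ s, zetaTerm l z)
      (L.lattice : Set ℂ)ᶜ :=
    .fun_sum fun l _ x hx ↦ (hd l x hx).differentiableAt.differentiableWithinAt
  have hlim := L.hasSumLocallyUniformly_zetaTerm.hasSumLocallyUniformlyOn
    (s := (L.lattice : Set ℂ)ᶜ)
  have hdS : DifferentiableAt ℂ (fun z ↦ ∑' l : L.lattice, zetaTerm l z) z :=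
    (hlim.differentiableOn (.of_forall hdiff) hU).differentiableAt (hU.mem_nhds hz)
  have hev : L.weierstrassZeta =ᶠ[𝓝 z] fun z ↦ ∑' l : L.lattice, zetaTerm l z := by
    filter_upwards [hU.mem_nhds hz] with y hy using L.weierstrassZeta_eq_tsum hy
  have hderiv : deriv (fun z ↦ ∑' l : L.lattice, zetaTerm l z) z = -L.weierstrassP z := by
    have h1 := (L.hasSumLocallyUniformly_zetaTerm.tendstoLocallyUniformlyOn.deriv
      (.of_forall hdiff) hU).tendsto_at hz
    refine tendsto_nhds_unique h1 ?_
    refine ((L.hasSum_weierstrassP z).neg).congr fun s ↦ ?_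
    simp only [Function.comp_apply]
    rw [deriv_fun_sum fun l _ ↦ (hd l z hz).differentiableAt]
    exact Finset.sum_congr rfl fun l _ ↦ (hd l z hz).deriv.symm
  rw [← hderiv]
  exact hdS.hasDerivAt.congr_of_eventuallyEq hev

lemma add_mem_lattice_iff {z ω : ℂ} (hω : ω ∈ L.lattice) : z + ω ∈ L.lattice ↔ z ∈ L.lattice :=
  L.lattice.add_mem_iff_left hω

lemma exists_weierstrassZeta_add {ω : ℂ} (hω : ω ∈ L.lattice) :
    ∃ η : ℂ, ∀ z ∉ L.lattice, L.weierstrassZeta (z + ω) = L.weierstrassZeta z + η := by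
  have hd (z : ℂ) (hz : z ∈ (L.lattice : Set ℂ)ᶜ) :
      HasDerivAt (fun z ↦ L.weierstrassZeta (z + ω) - L.weierstrassZeta z) 0 z := by
    have hz' : z + ω ∉ L.lattice := (L.add_mem_lattice_iff hω).not.mpr hz
    have h := ((L.hasDerivAt_weierstrassZeta hz').comp_add_const z ω).sub
      (L.hasDerivAt_weierstrassZeta hz)
    rw [L.weierstrassP_add_coe z ⟨ω, hω⟩, sub_self] at h
    exact h
  obtain ⟨η, hη⟩ := L.isOpen_compl_lattice.exists_is_const_of_deriv_eq_zero
    L.isPreconnected_compl_lattice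
    (fun z hz ↦ (hd z hz).differentiableAt.differentiableWithinAt) (fun z hz ↦ (hd z hz).deriv)
  exact ⟨η, fun z hz ↦ by rw [← hη z hz]; ring⟩

/-- Quasi-periodicity of the sigma function. -/
lemma exists_weierstrassSigma_add {ω : ℂ} (hω : ω ∈ L.lattice) :
    ∃ η C : ℂ, C ≠ 0 ∧ ∀ z,
      L.weierstrassSigma (z + ω) = C * Complex.exp (η * z) * L.weierstrassSigma z := by
  obtain ⟨η, hη⟩ := L.exists_weierstrassZeta_add hω
  set s := L.weierstrassSigma with hs
  have hsd : Differentiable ℂ s := L.differentiable_weierstrassSigma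
  have hd (z : ℂ) (hz : z ∈ (L.lattice : Set ℂ)ᶜ) :
      HasDerivAt (fun z ↦ s (z + ω) * Complex.exp (-η * z) / s z) 0 z := by
    have hz' : z + ω ∉ L.lattice := (L.add_mem_lattice_iff hω).not.mpr hz
    have h1 := L.weierstrassSigma_ne_zero hz
    have h2 := L.weierstrassSigma_ne_zero hz'
    have hζ := hη z hz
    rw [weierstrassZeta, weierstrassZeta, ← hs, div_add' _ _ _ h1, div_eq_div_iff h2 h1] at hζ
    have h := (((hsd (z + ω)).hasDerivAt.comp_add_const z ω).fun_mul
      (((hasDerivAt_id z).const_mul (-η)).cexp)).fun_div (hsd z).hasDerivAt h1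
    refine h.congr_deriv ?_
    rw [div_eq_zero_iff]
    left
    simp only [id]
    linear_combination Complex.exp (-η * z) * hζ
  obtain ⟨C, hC⟩ := L.isOpen_compl_lattice.exists_is_const_of_deriv_eq_zero
    L.isPreconnected_compl_lattice
    (fun z hz ↦ (hd z hz).differentiableAt.differentiableWithinAt) (fun z hz ↦ (hd z hz).deriv)
  have hoff (z : ℂ) (hz : z ∈ (L.lattice : Set ℂ)ᶜ) : s (z + ω) = C * Complex.exp (η * z) * s z := by
    have h1 : s z ≠ 0 := L.weierstrassSigma_ne_zero hz
    rw [← hC z hz, neg_mul, Complex.exp_neg]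
    have := Complex.exp_ne_zero (η * z)
    field_simp
  have hdense : Dense ((L.lattice : Set ℂ)ᶜ) :=
    Set.Countable.dense_compl ℝ (countable_of_Lindelof_of_discrete (X := L.lattice))
  have hall : (fun z ↦ s (z + ω)) = fun z ↦ C * Complex.exp (η * z) * s z :=
    Continuous.ext_on hdense (hsd.continuous.comp (continuous_add_const ω))
      (Continuous.mul (by fun_prop) hsd.continuous) hoff
  refine ⟨η, C, ?_, congrFun hall⟩
  rintro rfl
  have hm := L.ω₁_div_two_notMem_lattice
  have := hoff _ hm
  rw [zero_mul, zero_mul] at this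
  exact L.weierstrassSigma_ne_zero ((L.add_mem_lattice_iff hω).not.mpr hm) this

end PeriodPair

/-! ### Dividing entire functions -/

/-- If every zero of the entire function `P` is simple and is a zero of the entire function `G`,
then `P` divides `G` in the ring of entire functions. -/
lemma Complex.exists_eq_mul_of_simple_zeros {P G : ℂ → ℂ} (hP : Differentiable ℂ P)
    (hG : Differentiable ℂ G) (hsimple : ∀ z, P z = 0 → deriv P z ≠ 0)
    (hGP : ∀ z, P z = 0 → G z = 0) :
    ∃ E : ℂ → ℂ, Differentiable ℂ E ∧ ∀ z, G z = P z * E z := by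
  classical
  refine ⟨fun z ↦ if P z = 0 then deriv G z / deriv P z else G z / P z, fun z₀ ↦ ?_, fun z ↦ ?_⟩
  · by_cases h0 : P z₀ = 0
    · have hds {f : ℂ → ℂ} (hf : Differentiable ℂ f) : Differentiable ℂ (dslope f z₀) := by
        rw [← differentiableOn_univ] at hf ⊢
        exact (Complex.differentiableOn_dslope univ_mem).mpr hf
      have hne : dslope P z₀ z₀ ≠ 0 := by rw [dslope_same]; exact hsimple z₀ h0
      refine DifferentiableAt.congr_of_eventuallyEq
        ((hds hG z₀).fun_div (hds hP z₀) hne) ?_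
      filter_upwards [(hds hP z₀).continuousAt.eventually_ne hne] with z hz
      rcases eq_or_ne z z₀ with rfl | hzz
      · rw [if_pos h0, dslope_same, dslope_same]
      · have hzz' : z - z₀ ≠ 0 := sub_ne_zero.mpr hzz
        have eP := sub_smul_dslope P z₀ z
        have eG := sub_smul_dslope G z₀ z
        rw [h0, sub_zero, smul_eq_mul] at eP
        rw [hGP z₀ h0, sub_zero, smul_eq_mul] at eG
        rw [if_neg (eP ▸ mul_ne_zero hzz' hz), ← eP, ← eG, mul_div_mul_left _ _ hzz']
    · refine DifferentiableAt.congr_of_eventuallyEq ((hG z₀).fun_div (hP z₀) h0) ?_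
      filter_upwards [(hP z₀).continuousAt.eventually_ne h0] with z hz
      rw [if_neg hz]
  · dsimp only
    split_ifs with h
    · rw [h, zero_mul, hGP z h]
    · rw [mul_div_cancel₀ _ h]

namespace PeriodPair

variable (L : PeriodPair)

/-! ### Liouville's theorem for multiplicative functions -/

lemma apply_eq_apply_of_norm_periodic {F : ℂ → ℂ} (hF : Differentiable ℂ F)
    (h : ∀ ω ∈ L.lattice, ∀ z, ‖F (z + ω)‖ = ‖F z‖) (z w : ℂ) : F z = F w := by
  refine hF.apply_eq_apply_of_bounded ?_ z w
  have hc := (IsZLattice.isCompact_range_of_periodic L.lattice (fun z ↦ ‖F z‖)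
    hF.continuous.norm fun z w hw ↦ h w hw z).isBounded
  obtain ⟨B, hB⟩ := isBounded_iff_forall_norm_le.mp hc
  refine isBounded_iff_forall_norm_le.mpr ⟨B, ?_⟩
  rintro _ ⟨x, rfl⟩
  simpa using hB _ ⟨x, rfl⟩

/-- An entire function which vanishes at `0` and is multiplied by a nonzero constant under each
lattice translation is zero: for a suitable `a`, the modulus of `F(z) exp(-az)` is periodic. -/
lemma eq_zero_of_multiplicative {F : ℂ → ℂ} (hF : Differentiable ℂ F) (h0 : F 0 = 0)
    (h : ∀ ω ∈ L.lattice, ∃ C : ℂ, C ≠ 0 ∧ ∀ z, F (z + ω) = C * F z) (z : ℂ) : F z = 0 := by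
  obtain ⟨C₁, hC₁, hF₁⟩ := h _ L.ω₁_mem_lattice
  obtain ⟨C₂, hC₂, hF₂⟩ := h _ L.ω₂_mem_lattice
  let ρ : ℂ →ₗ[ℝ] ℝ := L.basis.constr ℝ ![Real.log ‖C₁‖, Real.log ‖C₂‖]
  -- Every `ℝ`-linear form on `ℂ` is `w ↦ Re (a w)` for some `a`.
  let a : ℂ := ρ 1 - ρ Complex.I * Complex.I
  have ha (w : ℂ) : (a * w).re = ρ w := by
    have hw : w = w.re • (1 : ℂ) + w.im • Complex.I := by simp
    conv_rhs => rw [hw, map_add, map_smul, map_smul]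
    simp [a]
    ring
  have hρ₁ : ρ L.ω₁ = Real.log ‖C₁‖ := by
    rw [← L.basis_zero]; simp only [ρ, Module.Basis.constr_basis]; simp
  have hρ₂ : ρ L.ω₂ = Real.log ‖C₂‖ := by
    rw [← L.basis_one]; simp only [ρ, Module.Basis.constr_basis]; simp
  set H : ℂ → ℂ := fun z ↦ F z * Complex.exp (-(a * z)) with hH
  have hper {ω C : ℂ} (hC : C ≠ 0) (hFω : ∀ z, F (z + ω) = C * F z)
      (hω : ρ ω = Real.log ‖C‖) (z : ℂ) : ‖H (z + ω)‖ = ‖H z‖ := by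
    have hCn : 0 < ‖C‖ := norm_pos_iff.mpr hC
    simp only [hH, hFω, norm_mul, Complex.norm_exp, Complex.neg_re, mul_add, Complex.add_re]
    rw [ha ω, hω, neg_add, Real.exp_add, Real.exp_neg (Real.log _), Real.exp_log hCn]
    field_simp
  let G : AddSubgroup ℂ :=
    { carrier := {w | ∀ z, ‖H (z + w)‖ = ‖H z‖}
      add_mem' := fun {x y} hx hy z ↦ by rw [← add_assoc, hy, hx]
      zero_mem' := fun z ↦ by rw [add_zero]
      neg_mem' := fun {x} hx z ↦ by rw [← hx (z + -x), neg_add_cancel_right] }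
  have hG : L.lattice ≤ G.toIntSubmodule := by
    rw [lattice, Submodule.span_le]
    rintro _ (rfl | rfl)
    · exact hper hC₁ hF₁ hρ₁
    · exact hper hC₂ hF₂ hρ₂
  have hHd : Differentiable ℂ H := hF.mul (by fun_prop)
  have := L.apply_eq_apply_of_norm_periodic hHd (fun ω hω ↦ hG hω) z 0
  simpa [hH, h0, Complex.exp_ne_zero] using this

/-- The quasi-periods of the zeta function do not depend `ℂ`-linearly on the period. -/
lemma not_forall_quasiPeriod_eq_mul (c : ℂ)
    (h : ∀ ω ∈ L.lattice, ∃ C : ℂ, C ≠ 0 ∧ ∀ z, L.weierstrassSigma (z + ω)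
      = C * Complex.exp (c * ω * z) * L.weierstrassSigma z) : False := by
  have hz := L.eq_zero_of_multiplicative
    (F := fun z ↦ L.weierstrassSigma z * Complex.exp (-(c * z ^ 2 / 2)))
    (L.differentiable_weierstrassSigma.mul (by fun_prop)) (by simp) (by
      intro ω hω
      obtain ⟨C, hC, hCz⟩ := h ω hω
      refine ⟨C * Complex.exp (-(c * ω ^ 2 / 2)), mul_ne_zero hC (Complex.exp_ne_zero _),
        fun z ↦ ?_⟩
      rw [hCz, show -(c * (z + ω) ^ 2 / 2)
        = -(c * ω * z) + -(c * ω ^ 2 / 2) + -(c * z ^ 2 / 2) by ring, Complex.exp_add,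
        Complex.exp_add, Complex.exp_neg (c * ω * z)]
      have := Complex.exp_ne_zero (c * ω * z)
      field_simp) (L.ω₁ / 2)
  exact mul_ne_zero (L.weierstrassSigma_ne_zero L.ω₁_div_two_notMem_lattice)
    (Complex.exp_ne_zero _) hz

/-! ### Theta functions -/

/-- `F` has the factors of automorphy of a product `∏ σ(z - aᵢ)` with `n` factors and
`∑ aᵢ = s`. The numbers `η, C` are those of `σ(z + ω) = C exp(η z) σ(z)`. -/
def HasSigmaMultiplier (n : ℕ) (s : ℂ) (F : ℂ → ℂ) : Prop :=
  ∀ ω ∈ L.lattice, ∀ η C : ℂ,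
    (∀ z, L.weierstrassSigma (z + ω) = C * Complex.exp (η * z) * L.weierstrassSigma z) →
    ∀ z, F (z + ω) = C ^ n * Complex.exp (η * (n * z - s)) * F z

variable {L}

lemma HasSigmaMultiplier.mul {m n : ℕ} {s t : ℂ} {F G : ℂ → ℂ}
    (hF : L.HasSigmaMultiplier m s F) (hG : L.HasSigmaMultiplier n t G) :
    L.HasSigmaMultiplier (m + n) (s + t) (fun z ↦ F z * G z) := by
  intro ω hω η C h z
  dsimp only
  rw [hF ω hω η C h, hG ω hω η C h, show η * (((m + n : ℕ) : ℂ) * z - (s + t))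
    = η * (m * z - s) + η * (n * z - t) by push_cast; ring, Complex.exp_add]
  ring

lemma hasSigmaMultiplier_sigma (a : ℂ) :
    L.HasSigmaMultiplier 1 a (fun z ↦ L.weierstrassSigma (z - a)) := by
  intro ω _ η C h z
  dsimp only
  rw [add_sub_right_comm, h]
  simp

lemma hasSigmaMultiplier_prod {ι : Type*} (s : Finset ι) (a : ι → ℂ) :
    L.HasSigmaMultiplier s.card (∑ i ∈ s, a i)
      (fun z ↦ ∏ i ∈ s, L.weierstrassSigma (z - a i)) := by
  classical
  induction s using Finset.induction_on with
  | empty => intro ω _ η C h z; simp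
  | insert i s hi ih =>
    simp only [Finset.card_insert_of_notMem hi, Finset.sum_insert hi, Finset.prod_insert hi]
    rw [add_comm]
    exact (hasSigmaMultiplier_sigma (a i)).mul ih

variable (L)

lemma deriv_weierstrassSigma_add {ω η C : ℂ} (h : ∀ z, L.weierstrassSigma (z + ω)
      = C * Complex.exp (η * z) * L.weierstrassSigma z) (z : ℂ) :
    deriv L.weierstrassSigma (z + ω) = C * Complex.exp (η * z) *
      (deriv L.weierstrassSigma z + η * L.weierstrassSigma z) := by
  have hs := L.differentiable_weierstrassSigma
  have h1 := (hs (z + ω)).hasDerivAt.comp_add_const z ω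
  rw [funext h] at h1
  have h2 := ((((hasDerivAt_id z).const_mul η).cexp).const_mul C).fun_mul (hs z).hasDerivAt
  rw [h1.unique h2]
  simp only [id]
  ring

lemma weierstrassSigma_eq_zero_iff {z : ℂ} : L.weierstrassSigma z = 0 ↔ z ∈ L.lattice := by
  refine ⟨fun h ↦ by_contra fun hz ↦ L.weierstrassSigma_ne_zero hz h, fun h ↦ ?_⟩
  obtain ⟨η, C, -, hC⟩ := L.exists_weierstrassSigma_add h
  simpa using hC 0

lemma deriv_weierstrassSigma_ne_zero {z : ℂ} (hz : z ∈ L.lattice) :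
    deriv L.weierstrassSigma z ≠ 0 := by
  obtain ⟨η, C, hC0, hC⟩ := L.exists_weierstrassSigma_add hz
  have h := L.deriv_weierstrassSigma_add hC 0
  simp only [zero_add, mul_zero, Complex.exp_zero, mul_one, deriv_weierstrassSigma_zero,
    weierstrassSigma_zero, add_zero] at h
  rwa [h]

/-! ### The residue identity -/

section Residue

variable {ι : Type*} [Fintype ι] [DecidableEq ι]

lemma deriv_prod_weierstrassSigma (a : ι → ℂ) (z : ℂ) :
    deriv (fun z ↦ ∏ i, L.weierstrassSigma (z - a i)) z
      = ∑ i, deriv L.weierstrassSigma (z - a i) *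
          ∏ l ∈ Finset.univ.erase i, L.weierstrassSigma (z - a l) := by
  have h (i : ι) : HasDerivAt (fun z ↦ L.weierstrassSigma (z - a i))
      (deriv L.weierstrassSigma (z - a i)) z :=
    (L.differentiable_weierstrassSigma (z - a i)).hasDerivAt.comp_sub_const z (a i)
  rw [(HasDerivAt.fun_finsetProd fun i _ ↦ h i).deriv]
  exact Finset.sum_congr rfl fun i _ ↦ by rw [smul_eq_mul, mul_comm]

/-- At a zero of the `i`-th factor only the `i`-th term of the product rule survives. -/
lemma deriv_prod_weierstrassSigma_of_eq_zero (a : ι → ℂ) (i : ι) {z : ℂ}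
    (hz : L.weierstrassSigma (z - a i) = 0) :
    deriv (fun z ↦ ∏ i, L.weierstrassSigma (z - a i)) z
      = deriv L.weierstrassSigma (z - a i) *
          ∏ l ∈ Finset.univ.erase i, L.weierstrassSigma (z - a l) := by
  rw [deriv_prod_weierstrassSigma]
  refine Finset.sum_eq_single_of_mem i (Finset.mem_univ i) fun l _ hl ↦ ?_
  rw [Finset.prod_eq_zero (Finset.mem_erase.mpr ⟨hl.symm, Finset.mem_univ i⟩) hz, mul_zero]

/-- The sum of the residues of the elliptic function `F / ∏ σ(z - aᵢ)`, all of whose poles are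
simple, is zero. -/
theorem sum_div_prod_weierstrassSigma_eq_zero (a : ι → ℂ)
    (ha : ∀ i j, i ≠ j → a i - a j ∉ L.lattice) {F : ℂ → ℂ} (hF : Differentiable ℂ F)
    (hFm : L.HasSigmaMultiplier (Fintype.card ι) (∑ i, a i) F) :
    ∑ i, F (a i) / ∏ l ∈ Finset.univ.erase i, L.weierstrassSigma (a i - a l) = 0 := by
  have hs := L.differentiable_weierstrassSigma
  have hs' : Differentiable ℂ (deriv L.weierstrassSigma) := fun z ↦
    (hs.analyticAt z).deriv.differentiableAt
  set c : ι → ℂ := fun i ↦ F (a i) / ∏ l ∈ Finset.univ.erase i, L.weierstrassSigma (a i - a l)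
  by_contra hR
  set R := ∑ i, c i with hRdef
  let P : ℂ → ℂ := fun z ↦ ∏ i, L.weierstrassSigma (z - a i)
  let D : ι → ℂ → ℂ := fun i z ↦ deriv L.weierstrassSigma (z - a i) *
    ∏ l ∈ Finset.univ.erase i, L.weierstrassSigma (z - a l)
  -- Subtracting from `F` the functions `cᵢ σ'(z - aᵢ) / σ(z - aᵢ) · P` kills all the residues.
  let G : ℂ → ℂ := fun z ↦ F z - ∑ i, c i * D i z
  have hPd : Differentiable ℂ P :=
    Differentiable.fun_finsetProd fun i _ ↦ hs.comp (differentiable_id.sub_const _)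
  have hDd (i : ι) : Differentiable ℂ (D i) :=
    (hs'.comp (differentiable_id.sub_const _)).mul
      (Differentiable.fun_finsetProd fun i _ ↦ hs.comp (differentiable_id.sub_const _))
  have hGd : Differentiable ℂ G :=
    hF.sub (Differentiable.fun_sum fun i _ ↦ (hDd i).const_mul _)
  have hPm : L.HasSigmaMultiplier (Fintype.card ι) (∑ i, a i) P := hasSigmaMultiplier_prod _ a
  have hPerase (i : ι) (z : ℂ) : P z = L.weierstrassSigma (z - a i) *
      ∏ l ∈ Finset.univ.erase i, L.weierstrassSigma (z - a l) :=
    (Finset.mul_prod_erase _ _ (Finset.mem_univ i)).symm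
  have hGm (ω : ℂ) (hω : ω ∈ L.lattice) (η C : ℂ)
      (h : ∀ z, L.weierstrassSigma (z + ω) = C * Complex.exp (η * z) * L.weierstrassSigma z)
      (z : ℂ) : G (z + ω) = C ^ Fintype.card ι *
        Complex.exp (η * (Fintype.card ι * z - ∑ i, a i)) * (G z - R * η * P z) := by
    have hD (i : ι) : D i (z + ω) = C ^ Fintype.card ι *
        Complex.exp (η * (Fintype.card ι * z - ∑ i, a i)) * (D i z + η * P z) := by
      have h1 := (hasSigmaMultiplier_prod (L := L) (Finset.univ.erase i) a) ω hω η C h z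
      have hcard : Fintype.card ι = (Finset.univ.erase i).card + 1 := by
        rw [Finset.card_erase_add_one (Finset.mem_univ i), Finset.card_univ]
      dsimp only [D] at h1 ⊢
      rw [hPerase i, h1, add_sub_right_comm, L.deriv_weierstrassSigma_add h, hcard,
        ← Finset.add_sum_erase _ a (Finset.mem_univ i)]
      rw [show η * (((Finset.univ.erase i).card + 1 : ℕ) * z
        - (a i + ∑ x ∈ Finset.univ.erase i, a x)) = η * (z - a i) +
          η * ((Finset.univ.erase i).card * z - ∑ x ∈ Finset.univ.erase i, a x) by
          push_cast; ring, Complex.exp_add]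
      ring
    have hsum : ∑ i, c i * D i (z + ω) = C ^ Fintype.card ι *
        Complex.exp (η * (Fintype.card ι * z - ∑ i, a i)) *
          (∑ i, c i * D i z + R * (η * P z)) := by
      rw [hRdef, Finset.sum_mul, ← Finset.sum_add_distrib, Finset.mul_sum]
      exact Finset.sum_congr rfl fun i _ ↦ by rw [hD]; ring
    dsimp only [G]
    rw [hFm ω hω η C h z, hsum]
    ring
  have hprod_ne {i : ι} {z : ℂ} (hz : z - a i ∈ L.lattice) :
      ∏ l ∈ Finset.univ.erase i, L.weierstrassSigma (z - a l) ≠ 0 := by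
    refine Finset.prod_ne_zero_iff.mpr fun l hl ↦ L.weierstrassSigma_ne_zero fun hzl ↦ ?_
    refine ha i l (Finset.ne_of_mem_erase hl).symm ?_
    have := sub_mem hzl hz
    rwa [sub_sub_sub_cancel_left] at this
  have hPzero {z : ℂ} (hz : P z = 0) : ∃ i, z - a i ∈ L.lattice := by
    obtain ⟨i, -, hi⟩ := Finset.prod_eq_zero_iff.mp hz
    exact ⟨i, L.weierstrassSigma_eq_zero_iff.mp hi⟩
  have hGa (i : ι) : G (a i) = 0 := by
    have h1 : ∑ l, c l * D l (a i) = c i * D i (a i) := by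
      refine Finset.sum_eq_single_of_mem i (Finset.mem_univ i) fun l _ hl ↦ ?_
      have : D l (a i) = 0 := by
        dsimp only [D]
        rw [Finset.prod_eq_zero (Finset.mem_erase.mpr ⟨hl.symm, Finset.mem_univ i⟩)
          (by simp), mul_zero]
      rw [this, mul_zero]
    have h2 := hprod_ne (i := i) (z := a i) (by simp)
    dsimp only [G]
    rw [h1]
    dsimp only [D, c]
    rw [sub_self, deriv_weierstrassSigma_zero, one_mul, div_mul_cancel₀ _ h2, sub_self]
  obtain ⟨E, hEd, hE⟩ := Complex.exists_eq_mul_of_simple_zeros hPd hGd (by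
    intro z hz
    obtain ⟨i, hi⟩ := hPzero hz
    rw [L.deriv_prod_weierstrassSigma_of_eq_zero a i (L.weierstrassSigma_eq_zero_iff.mpr hi)]
    exact mul_ne_zero (L.deriv_weierstrassSigma_ne_zero hi) (hprod_ne hi)) (by
    intro z hz
    obtain ⟨i, hi⟩ := hPzero hz
    obtain ⟨η, C, -, hC⟩ := L.exists_weierstrassSigma_add hi
    have h1 := hGm _ hi η C hC (a i)
    have h2 : P (a i) = 0 := by rw [hPerase i]; simp
    rwa [add_sub_cancel, hGa, h2, mul_zero, sub_zero, mul_zero] at h1)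
  have hEη (ω : ℂ) (hω : ω ∈ L.lattice) (η C : ℂ) (hC0 : C ≠ 0)
      (h : ∀ z, L.weierstrassSigma (z + ω) = C * Complex.exp (η * z) * L.weierstrassSigma z) :
      ∀ z, E (z + ω) = E z - R * η := by
    have hdense : Dense {z | P z ≠ 0} := by
      have hcount : (⋃ i, {z | z - a i ∈ L.lattice}).Countable := by
        refine countable_iUnion fun i ↦ ?_
        have hc : (L.lattice : Set ℂ).Countable :=
          countable_of_Lindelof_of_discrete (X := L.lattice)
        exact hc.preimage sub_left_injective
      have hd : Dense (⋃ i, {z | z - a i ∈ L.lattice})ᶜ := Set.Countable.dense_compl ℝ hcount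
      refine hd.mono fun z hz ↦ ?_
      intro hPz
      obtain ⟨i, hi⟩ := hPzero hPz
      exact hz (mem_iUnion.mpr ⟨i, hi⟩)
    refine congrFun (Continuous.ext_on hdense (f := fun z ↦ E (z + ω))
      (hEd.continuous.comp (continuous_add_const ω)) (hEd.continuous.sub continuous_const) ?_)
    intro z hz
    have h1 := hGm ω hω η C h z
    rw [hE, hE, hPm ω hω η C h z] at h1
    have hM : C ^ Fintype.card ι * Complex.exp (η * (Fintype.card ι * z - ∑ i, a i)) * P z ≠ 0 :=
      mul_ne_zero (mul_ne_zero (pow_ne_zero _ hC0) (Complex.exp_ne_zero _)) hz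
    refine mul_left_cancel₀ hM (h1.trans ?_)
    ring
  have hE'd : Differentiable ℂ (deriv E) := fun z ↦
    (hEd.analyticAt z).deriv.differentiableAt
  have hE'const (z : ℂ) : deriv E z = deriv E 0 := by
    refine L.apply_eq_apply_of_norm_periodic hE'd (fun ω hω z ↦ ?_) z 0
    obtain ⟨η, C, hC0, hC⟩ := L.exists_weierstrassSigma_add hω
    have h1 := ((hEd (z + ω)).hasDerivAt.comp_add_const z ω).add_const (R * η)
    have h2 : (fun z ↦ E (z + ω) + R * η) = E := by
      ext z; rw [hEη ω hω η C hC0 hC]; ring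
    rw [h2] at h1
    rw [h1.deriv]
  have hElin (z : ℂ) : E z - deriv E 0 * z = E 0 := by
    have hd : ∀ z, HasDerivAt (fun z ↦ E z - deriv E 0 * z) 0 z := fun z ↦ by
      have := (hEd z).hasDerivAt.sub ((hasDerivAt_id z).const_mul (deriv E 0))
      rwa [hE'const z, mul_one, sub_self] at this
    have := is_const_of_deriv_eq_zero (fun z ↦ (hd z).differentiableAt) (fun z ↦ (hd z).deriv) z 0
    simpa using this
  refine L.not_forall_quasiPeriod_eq_mul (-(deriv E 0) / R) fun ω hω ↦ ?_
  obtain ⟨η, C, hC0, hC⟩ := L.exists_weierstrassSigma_add hω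
  have hη : -(deriv E 0) / R * ω = η := by
    have h1 := hEη ω hω η C hC0 hC 0
    have h2 := hElin ω
    rw [zero_add] at h1
    rw [div_mul_eq_mul_div, div_eq_iff hR]
    linear_combination h2 - h1
  exact ⟨C, hC0, hη ▸ hC⟩

end Residue

/-! ### The linear system -/

lemma sigmaMulZetaNeg_eq (w : ℂ) : L.sigmaMulZetaNeg w = -deriv L.weierstrassSigma w := by
  unfold sigmaMulZetaNeg
  split_ifs with hw
  · rfl
  · have := L.weierstrassSigma_ne_zero hw
    rw [weierstrassZeta, deriv_weierstrassSigma_neg, weierstrassSigma_neg]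
    field_simp

/-- The Wronskian-like combination of two translates of `σ` has the multipliers of their product:
the terms coming from the factors `exp(η z)` cancel. -/
lemma hasSigmaMultiplier_deriv_mul_sub (a c : ℂ) :
    L.HasSigmaMultiplier 2 (a + c) (fun z ↦
      deriv L.weierstrassSigma (z - a) * L.weierstrassSigma (z - c)
        - L.weierstrassSigma (z - a) * deriv L.weierstrassSigma (z - c)) := by
  intro ω _ η C h z
  dsimp only
  rw [add_sub_right_comm, add_sub_right_comm, h, h, L.deriv_weierstrassSigma_add h,
    L.deriv_weierstrassSigma_add h, show η * (((2 : ℕ) : ℂ) * z - (a + c))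
    = η * (z - a) + η * (z - c) by push_cast; ring, Complex.exp_add]
  ring

variable {N : ℕ} {q : ℂ} {t lam : Fin N → ℂ}

lemma card_erase_add_one_eq (k : Fin N) : (Finset.univ.erase k).card + 1 = N := by
  rw [Finset.card_erase_add_one (Finset.mem_univ k), Finset.card_univ, Fintype.card_fin]

lemma differentiable_prod_sigma (s : Finset (Fin N)) (a : Fin N → ℂ) :
    Differentiable ℂ (fun z ↦ ∏ i ∈ s, L.weierstrassSigma (z - a i)) :=
  Differentiable.fun_finsetProd fun _ _ ↦
    L.differentiable_weierstrassSigma.comp (differentiable_id.sub_const _)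

/-- The columns of the explicit inverse satisfy `∑ⱼ Xⱼ = 0`. -/
lemma sum_sigma_quotient_eq_zero (ht : ∀ i j, i ≠ j → t i - t j ∉ L.lattice)
    (hsum : ∑ j, lam j - ∑ j, t j = q) (k : Fin N) :
    ∑ j, (∏ i ∈ Finset.univ.erase k, L.weierstrassSigma (t j - lam i)) *
        L.weierstrassSigma (t j - lam k + q) /
      ∏ l ∈ Finset.univ.erase j, L.weierstrassSigma (t j - t l) = 0 := by
  have hm := (hasSigmaMultiplier_prod (L := L) (Finset.univ.erase k) lam).mul
    (hasSigmaMultiplier_sigma (lam k - q))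
  have e : ∑ i ∈ Finset.univ.erase k, lam i + (lam k - q) = ∑ j, t j := by
    have := Finset.sum_erase_add _ lam (Finset.mem_univ k)
    linear_combination this + hsum
  rw [card_erase_add_one_eq, e] at hm
  have h := L.sum_div_prod_weierstrassSigma_eq_zero t ht
    ((L.differentiable_prod_sigma _ lam).mul
      (L.differentiable_weierstrassSigma.comp (differentiable_id.sub_const (lam k - q))))
    (by rw [Fintype.card_fin]; exact hm)
  simpa only [Pi.mul_apply, Function.comp_apply, id, ← sub_add] using h

/-- The residue identity with the additional pole `λₘ`: it evaluates the `m`-th equation at a column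
of the explicit inverse. -/
lemma sum_sigma_quotient_mul_zeta (ht : ∀ i j, i ≠ j → t i - t j ∉ L.lattice)
    (hlamt : ∀ k j, lam k - t j ∉ L.lattice)
    (hsum : ∑ j, lam j - ∑ j, t j = q) (k m : Fin N) :
    ∑ j, (∏ i ∈ Finset.univ.erase k, L.weierstrassSigma (t j - lam i)) *
        (L.weierstrassZeta (lam m - t j) * L.weierstrassSigma (t j - lam k + q)
          + deriv L.weierstrassSigma (t j - lam k + q)) /
      ∏ l ∈ Finset.univ.erase j, L.weierstrassSigma (t j - t l)
    = (∏ i ∈ Finset.univ.erase k, L.weierstrassSigma (lam m - lam i)) *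
        L.weierstrassSigma (lam m - lam k + q) / ∏ j, L.weierstrassSigma (lam m - t j) := by
  have htl (j) : t j - lam m ∉ L.lattice := by
    rw [← neg_sub, neg_mem_iff]; exact hlamt m j
  let a : Option (Fin N) → ℂ := fun o ↦ o.elim (lam m) t
  have ha : ∀ i j, i ≠ j → a i - a j ∉ L.lattice := by
    rintro (_ | i) (_ | j) hij
    · exact (hij rfl).elim
    · exact hlamt m j
    · exact htl i
    · exact ht i j fun h ↦ hij (h ▸ rfl)
  have hm := (hasSigmaMultiplier_prod (L := L) (Finset.univ.erase k) lam).mul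
    (L.hasSigmaMultiplier_deriv_mul_sub (lam k - q) (lam m))
  have e : ∑ i ∈ Finset.univ.erase k, lam i + (lam k - q + lam m) = ∑ o, a o := by
    rw [Fintype.sum_option]
    have := Finset.sum_erase_add _ lam (Finset.mem_univ k)
    simp only [a, Option.elim]
    linear_combination this + hsum
  have e' : (Finset.univ.erase k).card + 2 = Fintype.card (Option (Fin N)) := by
    rw [Fintype.card_option, Fintype.card_fin]
    have := card_erase_add_one_eq k
    omega
  rw [e, e'] at hm
  have hs := L.differentiable_weierstrassSigma
  have hs' : Differentiable ℂ (deriv L.weierstrassSigma) := fun z ↦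
    (hs.analyticAt z).deriv.differentiableAt
  have h := L.sum_div_prod_weierstrassSigma_eq_zero a ha
    ((L.differentiable_prod_sigma _ lam).mul
      (((hs'.comp (differentiable_id.sub_const (lam k - q))).mul
        (hs.comp (differentiable_id.sub_const (lam m)))).sub
      ((hs.comp (differentiable_id.sub_const (lam k - q))).mul
        (hs'.comp (differentiable_id.sub_const (lam m))))))
    hm
  have enone : Finset.univ.erase (none : Option (Fin N)) = Finset.univ.map .some := by
    ext (_ | x) <;> simp
  have esome (j : Fin N) : Finset.univ.erase (some j) = Finset.insertNone (Finset.univ.erase j) := by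
    ext (_ | x) <;> simp
  rw [Fintype.sum_option] at h
  simp only [enone, esome, Finset.prod_map, Finset.prod_insertNone, Function.Embedding.some_apply,
    a, Option.elim, Pi.mul_apply, Pi.sub_apply, Function.comp_apply, id, sub_self,
    weierstrassSigma_zero, deriv_weierstrassSigma_zero, ← sub_add, mul_zero, mul_one,
    zero_sub, mul_neg, neg_div] at h
  rw [← sub_eq_zero, sub_eq_neg_add, ← h]
  congr 1
  refine Finset.sum_congr rfl fun j _ ↦ ?_
  have h1 := L.weierstrassSigma_ne_zero (htl j)
  have h2 : ∏ l ∈ Finset.univ.erase j, L.weierstrassSigma (t j - t l) ≠ 0 :=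
    Finset.prod_ne_zero_iff.mpr fun l hl ↦
      L.weierstrassSigma_ne_zero (ht j l (Finset.ne_of_mem_erase hl).symm)
  rw [weierstrassZeta, ← neg_sub (t j) (lam m), weierstrassSigma_neg, deriv_weierstrassSigma_neg]
  field_simp
  ring

lemma deriv_sigmaProd (a : Fin N → ℂ) (k : Fin N) :
    deriv (L.sigmaProd a) (a k)
      = ∏ l ∈ Finset.univ.erase k, L.weierstrassSigma (a k - a l) := by
  have h := L.deriv_prod_weierstrassSigma_of_eq_zero a k (z := a k) (by simp)
  rw [sub_self, deriv_weierstrassSigma_zero, one_mul] at h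
  exact h

lemma sigmaProd_eq_mul (a : Fin N → ℂ) (k : Fin N) (z : ℂ) :
    L.sigmaProd a z = L.weierstrassSigma (z - a k) *
      ∏ l ∈ Finset.univ.erase k, L.weierstrassSigma (z - a l) :=
  (Finset.mul_prod_erase _ _ (Finset.mem_univ k)).symm

theorem solvesZetaSystem_explicit
    (ht : ∀ i j, i ≠ j → t i - t j ∉ L.lattice)
    (hlam : ∀ i j, i ≠ j → lam i - lam j ∉ L.lattice)
    (hlamt : ∀ k j, lam k - t j ∉ L.lattice)
    (hq : L.weierstrassSigma q ≠ 0)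
    (hsum : ∑ j, lam j - ∑ j, t j = q) (b : Fin N → ℂ) :
    L.SolvesZetaSystem t lam b (L.zetaSystemX₀ q t lam b) (L.zetaSystemX q t lam b) := by
  have htl (j k) : L.weierstrassSigma (t j - lam k) ≠ 0 := L.weierstrassSigma_ne_zero <| by
    rw [← neg_sub, neg_mem_iff]; exact hlamt k j
  let κ : Fin N → ℂ := fun k ↦
    L.sigmaProd t (lam k) / (deriv (L.sigmaProd lam) (lam k) * L.weierstrassSigma q) * b k
  have hcoef (j k : Fin N) (x : ℂ) :
      L.sigmaProd lam (t j) * L.sigmaProd t (lam k) * x * b k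
        / (deriv (L.sigmaProd t) (t j) * deriv (L.sigmaProd lam) (lam k)
          * L.weierstrassSigma (t j - lam k) * L.weierstrassSigma q)
      = κ k * ((∏ i ∈ Finset.univ.erase k, L.weierstrassSigma (t j - lam i)) * x /
        ∏ l ∈ Finset.univ.erase j, L.weierstrassSigma (t j - t l)) := by
    rw [L.sigmaProd_eq_mul lam k (t j), L.deriv_sigmaProd t j]
    have := htl j k
    dsimp only [κ]
    field_simp
  refine ⟨fun m ↦ ?_, ?_⟩
  · have h1 : ∑ j, L.weierstrassZeta (lam m - t j) * L.zetaSystemX q t lam b j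
        + L.zetaSystemX₀ q t lam b
        = ∑ k, κ k * ((∏ i ∈ Finset.univ.erase k, L.weierstrassSigma (lam m - lam i)) *
          L.weierstrassSigma (lam m - lam k + q) / ∏ j, L.weierstrassSigma (lam m - t j)) := by
      simp_rw [← L.sum_sigma_quotient_mul_zeta ht hlamt hsum _ m, zetaSystemX, zetaSystemX₀, hcoef,
        sigmaMulZetaNeg_eq, Finset.mul_sum]
      rw [← Finset.sum_neg_distrib, ← Finset.sum_add_distrib, Finset.sum_comm]
      refine Finset.sum_congr rfl fun j _ ↦ ?_
      rw [← Finset.sum_neg_distrib, ← Finset.sum_add_distrib]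
      exact Finset.sum_congr rfl fun k _ ↦ by ring
    rw [h1, Finset.sum_eq_single_of_mem m (Finset.mem_univ m)]
    · have h2 : ∏ i ∈ Finset.univ.erase m, L.weierstrassSigma (lam m - lam i) ≠ 0 :=
        Finset.prod_ne_zero_iff.mpr fun l hl ↦
          L.weierstrassSigma_ne_zero (hlam m l (Finset.ne_of_mem_erase hl).symm)
      have h3 : ∏ j, L.weierstrassSigma (lam m - t j) ≠ 0 :=
        Finset.prod_ne_zero_iff.mpr fun j _ ↦ L.weierstrassSigma_ne_zero (hlamt m j)
      dsimp only [κ]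
      rw [L.deriv_sigmaProd lam m, sub_self, zero_add, sigmaProd]
      field_simp
    · intro k _ hk
      rw [Finset.prod_eq_zero (Finset.mem_erase.mpr ⟨hk.symm, Finset.mem_univ m⟩) (by simp)]
      simp
  · simp_rw [zetaSystemX, hcoef]
    rw [Finset.sum_comm]
    simp_rw [← Finset.mul_sum, L.sum_sigma_quotient_eq_zero ht hsum, mul_zero]
    exact Finset.sum_const_zero

/-- Since the system is square, its solvability for all `b` implies that its homogeneous form has
only the trivial solution. -/
theorem solvesZetaSystem_unique (hN : 0 < N)
    (hsolve : ∀ b, ∃ X₀ X, L.SolvesZetaSystem t lam b X₀ X) {b : Fin N → ℂ}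
    {X₀ Y₀ : ℂ} {X Y : Fin N → ℂ} (hX : L.SolvesZetaSystem t lam b X₀ X)
    (hY : L.SolvesZetaSystem t lam b Y₀ Y) : (X₀, X) = (Y₀, Y) := by
  let T : (ℂ × (Fin N → ℂ)) →ₗ[ℂ] ((Fin N → ℂ) × ℂ) :=
    { toFun := fun p ↦
        (fun k ↦ ∑ j, L.weierstrassZeta (lam k - t j) * p.2 j + p.1, ∑ j, p.2 j)
      map_add' := fun p r ↦ by
        ext
        · simp only [Prod.fst_add, Prod.snd_add, Pi.add_apply, mul_add, Finset.sum_add_distrib]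
          ring
        · simp [Finset.sum_add_distrib]
      map_smul' := fun c p ↦ by
        ext
        · simp only [Prod.smul_fst, Prod.smul_snd, Pi.smul_apply, smul_eq_mul, RingHom.id_apply,
            mul_add, Finset.mul_sum]
          congr 1
          exact Finset.sum_congr rfl fun _ _ ↦ by ring
        · simp [Finset.mul_sum] }
  have hsurj : Function.Surjective T := by
    rintro ⟨c, β⟩
    -- A first vector with entry sum `β` reduces the claim to the solvable case `∑ⱼ Xⱼ = 0`.
    let v : ℂ × (Fin N → ℂ) := (0, Pi.single ⟨0, hN⟩ β)
    obtain ⟨Z₀, Z, h1, h2⟩ := hsolve (c - (T v).1)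
    refine ⟨(Z₀, Z) + v, ?_⟩
    have hZ : T (Z₀, Z) = (c - (T v).1, 0) := Prod.ext (funext h1) h2
    have hv : (T v).2 = β := by simp [T, v]
    rw [map_add, hZ]
    exact Prod.ext (by simp) (by simp [hv])
  have hinj : Function.Injective T :=
    (LinearMap.injective_iff_surjective_of_finrank_eq_finrank
      (by simp [Module.finrank_prod, add_comm])).mpr hsurj
  exact hinj (Prod.ext (funext fun k ↦ (hX.1 k).trans (hY.1 k).symm) (hX.2.trans hY.2.symm))

end PeriodPair

end

theorem lemma2 (L : PeriodPair) (N : ℕ) (q : ℂ) (t lam : Fin N → ℂ)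
    (ht : ∀ i j, i ≠ j → t i - t j ∉ L.lattice)
    (hlam : ∀ i j, i ≠ j → lam i - lam j ∉ L.lattice)
    (hlamt : ∀ k j, lam k - t j ∉ L.lattice)
    (hq : L.weierstrassSigma q ≠ 0)
    (hsum : ∑ j, lam j - ∑ j, t j = q)
    (b : Fin N → ℂ) :
    (∃! Y : ℂ × (Fin N → ℂ), L.SolvesZetaSystem t lam b Y.1 Y.2) ∧
      L.SolvesZetaSystem t lam b (L.zetaSystemX₀ q t lam b) (L.zetaSystemX q t lam b) := by
  have hN : 0 < N := by
    rcases Nat.eq_zero_or_pos N with rfl | h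
    · -- With no points, `q = 0` is a zero of `σ`.
      simp only [Finset.univ_eq_empty, Finset.sum_empty, sub_zero] at hsum
      exact (hq (by rw [← hsum, L.weierstrassSigma_zero])).elim
    · exact h
  have hsol (b : Fin N → ℂ) := L.solvesZetaSystem_explicit ht hlam hlamt hq hsum b
  exact ⟨⟨(_, _), hsol b, fun _ hY ↦
    L.solvesZetaSystem_unique hN (fun b ↦ ⟨_, _, hsol b⟩) hY (hsol b)⟩, hsol b⟩
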